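/- Let $\mathfrak{sl}_4$ be the $15$-dimensional complex Lie algebra of traceless $4\times 4$ complex matrices with the bracket $[x,y]=xy-yx$, and let $T_{\mathfrak{sl}_4}\in \mathfrak{sl}_4^*\otimes \mathfrak{sl}_4^*\otimes \mathfrak{sl}_4$ be its structure tensor, i.e. the tensor corresponding to the bilinear map $(x,y)\mapsto[x,y]$. For finite-dimensional complex vector spaces $A,B,C$, the rank of a tensor $T\in A\otimes B\otimes C$ is the least $r$ such that $T=\sum_{i=1}^r a_i\otimes b_i\otimes c_i$ with $a_i\in A$, $b_i\in B$, $c_i\in C$, and the border rank $\underline{\mathbf R}(T)$ is the least $r$ such that $T=\lim_{\epsilon\to0^+}T_\epsilon$ for some tensors $T_\epsilon\in A\otimes B\otimes C$ ($\epsilon>0$) of rank $r$. Then $$\underline{\mathbf R}(T_{\mathfrak{sl}_4})\ \ge\ 28 .$$ -/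

import Mathlib

open scoped TensorProduct Topology

/-- The rank of a tensor `T ∈ A ⊗ B ⊗ C`: the least `r` such that `T` is a sum of `r` decomposable
tensors `a ⊗ b ⊗ c`. Every tensor is such a sum for some `r`, so the infimum is a minimum. -/
noncomputable def tensorRank {A B C : Type*}
    [AddCommGroup A] [Module ℂ A] [AddCommGroup B] [Module ℂ B] [AddCommGroup C] [Module ℂ C]
    (T : A ⊗[ℂ] (B ⊗[ℂ] C)) : ℕ :=
  sInf {r : ℕ | ∃ (a : Fin r → A) (b : Fin r → B) (c : Fin r → C),
    T = ∑ i, a i ⊗ₜ[ℂ] (b i ⊗ₜ[ℂ] c i)}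

/-- Convergence `lim_{ε → 0⁺} F ε = T` in a complex vector space `V` with respect to the module
topology. When `V` is finite-dimensional this is its usual (Euclidean) topology. -/
def TendstoAtZero {V : Type*} [AddCommGroup V] [Module ℂ V] (F : ℝ → V) (T : V) : Prop :=
  Filter.Tendsto F (𝓝[>] (0 : ℝ)) (@nhds V (moduleTopology ℂ V) T)

/-- The border rank of a tensor `T ∈ A ⊗ B ⊗ C` (for finite-dimensional `A`, `B`, `C`): the least
`r` such that `T = lim_{ε → 0} T_ε` for some tensors `T_ε` (`ε > 0`) of rank `r`. The constant
family shows that `r = tensorRank T` is possible, so the infimum is a minimum. -/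
noncomputable def borderRank {A B C : Type*}
    [AddCommGroup A] [Module ℂ A] [AddCommGroup B] [Module ℂ B] [AddCommGroup C] [Module ℂ C]
    (T : A ⊗[ℂ] (B ⊗[ℂ] C)) : ℕ :=
  sInf {r : ℕ | ∃ F : ℝ → A ⊗[ℂ] (B ⊗[ℂ] C),
    (∀ ε : ℝ, 0 < ε → tensorRank (F ε) = r) ∧ TendstoAtZero F T}

/-- The tensor in `U* ⊗ V* ⊗ W` that corresponds to a bilinear map `U × V → W` under the canonical
isomorphisms `Hom(U, Hom(V, W)) ≃ U* ⊗ Hom(V, W) ≃ U* ⊗ (V* ⊗ W)`. -/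
noncomputable def bilinearTensor {U V W : Type*}
    [AddCommGroup U] [Module ℂ U] [FiniteDimensional ℂ U]
    [AddCommGroup V] [Module ℂ V] [FiniteDimensional ℂ V] [AddCommGroup W] [Module ℂ W]
    (f : U →ₗ[ℂ] V →ₗ[ℂ] W) : Module.Dual ℂ U ⊗[ℂ] (Module.Dual ℂ V ⊗[ℂ] W) :=
  (dualTensorHomEquiv ℂ U (Module.Dual ℂ V ⊗[ℂ] W)).symm
    ((dualTensorHomEquiv ℂ V W).symm.toLinearMap ∘ₗ f)

/-- The structure tensor in `L* ⊗ L* ⊗ L` of a finite-dimensional complex Lie algebra `L`: the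
tensor of the bilinear map `(x, y) ↦ ⁅x, y⁆`. -/
noncomputable def structureTensor (L : Type*) [LieRing L] [LieAlgebra ℂ L]
    [FiniteDimensional ℂ L] : Module.Dual ℂ L ⊗[ℂ] (Module.Dual ℂ L ⊗[ℂ] L) :=
  bilinearTensor (LieModule.toEnd ℂ L L : L →ₗ[ℂ] L →ₗ[ℂ] L)

/-! Suppose the border rank is at most 27. Border substitution: each approximating tensor loses one
summand when its first argument is restricted to a suitable hyperplane. Hyperplanes form a compact
space, so on some limit hyperplane `a = 0` of `sl₄` the bracket is a limit of tensors of rank at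
most 26 (`exists_hyperplane_det_eq_zero`). Restricted further to nine vectors of that hyperplane,
its Koszul flattening with `p = 4` has rank at most `26 * (8.choose 4) = 1820`, because a rank one
tensor contributes at most `8.choose 4 = 70` (`rank_koszulMatrix_sum_le`).

This is contradicted by finding, in every hyperplane, nine vectors whose flattening has rank at
least 1821 (`exists_det_koszulMatrix_lie_ne_zero`). After a conjugation `a` is nonzero on the lower
left matrix unit. A one-parameter torus then moves the hyperplane arbitrarily close to the
hyperplane of matrices with lower left entry zero. Nonvanishing of a minor is an open condition and
the bracket is conjugation invariant, so one explicit choice of nine matrices in the limit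
hyperplane suffices.

For that choice the flattening is an integer matrix, block decomposed by a grading of the matrix
units. Gaussian elimination modulo 3 yields 1821 independent rows, hence an integer compression with
nonzero determinant, which stays nonzero over `ℂ`. -/

/-! ### Koszul flattenings and their rank on sums of decomposable arrays. -/

/-- The sign of moving `k` past the elements of `S` that precede it. -/
def koszulSign {n : ℕ} (S : Finset (Fin n)) (k : Fin n) : ℤ :=
  ∏ j ∈ S, if j < k then -1 else 1

/-- The coefficient of `e_{S'}` in `± α ∧ e_S`, where `α = ∑ k, α k e_k`. -/
def wedgeCoeff {n : ℕ} {R : Type*} [CommRing R] (α : Fin n → R) (S S' : Finset (Fin n)) : R :=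
  ∑ k, if k ∉ S ∧ insert k S = S' then (koszulSign S k : R) * α k else 0

/-- The matrix of the Koszul flattening `Λ^p ⊗ B → Λ^(p+1) ⊗ C` of a three-way array. -/
def koszulMatrix {n : ℕ} (p : ℕ) {ι κ R : Type*} [CommRing R] (t : Fin n → ι → κ → R) :
    Matrix ({S : Finset (Fin n) // S.card = p} × ι) (Finset (Fin n) × κ) R :=
  Matrix.of fun r c => wedgeCoeff (fun k => t k r.2 c.2) r.1.1 c.1

theorem koszulSign_ne_zero {n : ℕ} (S : Finset (Fin n)) (k : Fin n) : koszulSign S k ≠ 0 := by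
  unfold koszulSign
  refine Finset.prod_ne_zero_iff.2 fun j _ => ?_
  split_ifs <;> decide

theorem koszulSign_insert {n : ℕ} (S : Finset (Fin n)) {k : Fin n} (hk : k ∉ S) (l : Fin n) :
    koszulSign (insert k S) l = (if k < l then -1 else 1) * koszulSign S l := by
  simp [koszulSign, Finset.prod_insert hk]

/-- `α ∧ α ∧ e_S = 0`. -/
theorem sum_mul_wedgeCoeff_insert {n : ℕ} {R : Type*} [CommRing R] [CharZero R] [IsDomain R]
    (α : Fin n → R) (S S' : Finset (Fin n)) :
    ∑ k, (if k ∉ S then (koszulSign S k : R) * α k else 0) * wedgeCoeff α (insert k S) S' = 0 := by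
  set F : Fin n → Fin n → R := fun k l =>
    (if k ∉ S then (koszulSign S k : R) * α k else 0) *
      (if l ∉ insert k S ∧ insert l (insert k S) = S' then
        (koszulSign (insert k S) l : R) * α l else 0) with hF
  have hanti : ∀ k l, F k l = - F l k := by
    intro k l
    by_cases hkl : k = l
    · subst hkl
      simp [hF]
    by_cases hk : k ∈ S
    · simp [hF, hk]
    by_cases hl : l ∈ S
    · simp [hF, hl]
    have hlk : l ≠ k := fun h => hkl h.symm
    simp only [hF, hk, hl, Finset.mem_insert, hkl, hlk, not_false_eq_true, if_true, true_and,
      or_self, koszulSign_insert S hk, koszulSign_insert S hl, Finset.insert_comm k l]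
    by_cases h : insert l (insert k S) = S'
    · rcases lt_or_gt_of_ne hkl with h1 | h1
      · simp [h, h1, not_lt.2 h1.le]; ring
      · simp [h, h1, not_lt.2 h1.le]; ring
    · simp [h]
  have hsum : ∑ k, (if k ∉ S then (koszulSign S k : R) * α k else 0) *
      wedgeCoeff α (insert k S) S' = ∑ k, ∑ l, F k l := by
    simp [hF, wedgeCoeff, Finset.mul_sum]
  rw [hsum]
  have h2 : ∑ k, ∑ l, F k l = - ∑ k, ∑ l, F k l := by
    conv_lhs => rw [Finset.sum_comm]
    simp only [← Finset.sum_neg_distrib]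
    exact Finset.sum_congr rfl fun k _ => Finset.sum_congr rfl fun l _ => hanti l k
  exact self_eq_neg.1 h2

/-- The `p`-subsets of `Fin n` that avoid a fixed index. -/
abbrev AvoidingSubset {n : ℕ} (p : ℕ) (j : Fin n) : Type :=
  {U : Finset (Fin n) // U.card = p ∧ j ∉ U}

theorem card_avoidingSubset {n : ℕ} (p : ℕ) (j : Fin n) :
    Fintype.card (AvoidingSubset p j) = (n - 1).choose p := by
  rw [Fintype.card_subtype]
  have : (Finset.univ.filter fun U : Finset (Fin n) => U.card = p ∧ j ∉ U) =
      Finset.powersetCard p (Finset.univ.erase j) := by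
    ext U
    simp only [Finset.mem_filter, Finset.mem_univ, true_and, Finset.mem_powersetCard,
      Finset.subset_erase, Finset.subset_univ]
    tauto
  rw [this, Finset.card_powersetCard]
  simp

/-- If `α j ≠ 0`, the products `α ∧ e_U` with `j ∉ U` span all products `α ∧ e_S`. -/
theorem exists_wedgeCoeff_eq_sum_avoiding {n p : ℕ} {R : Type*} [Field R] [CharZero R]
    (α : Fin n → R) {j : Fin n} (hj : α j ≠ 0) (S : Finset (Fin n)) (hS : S.card = p) :
    ∃ c : AvoidingSubset p j → R, ∀ S', wedgeCoeff α S S' = ∑ U, c U * wedgeCoeff α U.1 S' := by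
  by_cases hjS : j ∈ S
  · set T := S.erase j with hT
    have hjT : j ∉ T := Finset.notMem_erase j S
    have hST : insert j T = S := Finset.insert_erase hjS
    set a : R := (koszulSign T j : R) * α j with ha
    have ha0 : a ≠ 0 := mul_ne_zero (by exact_mod_cast koszulSign_ne_zero T j) hj
    refine ⟨fun U => -a⁻¹ * ∑ k, if k ∉ T ∧ k ≠ j ∧ insert k T = U.1 then
      (koszulSign T k : R) * α k else 0, fun S' => ?_⟩
    have key := sum_mul_wedgeCoeff_insert α T S'
    -- In the relation `α ∧ α ∧ e_T = 0` the term `k = j` is `± α j` times `α ∧ e_S`. Solving for it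
    -- leaves only sets `insert k T` with `k ≠ j`, which avoid `j`.
    rw [← Finset.add_sum_erase _ _ (Finset.mem_univ j), if_pos hjT, hST, ← ha] at key
    have hw : wedgeCoeff α S S' = -a⁻¹ * ∑ k ∈ Finset.univ.erase j,
        (if k ∉ T then (koszulSign T k : R) * α k else 0) * wedgeCoeff α (insert k T) S' := by
      rw [eq_neg_of_add_eq_zero_right key]
      field_simp
    rw [hw]
    simp only [mul_assoc, ← Finset.mul_sum, Finset.sum_mul]
    congr 1
    rw [Finset.sum_comm, ← Finset.add_sum_erase _ _ (Finset.mem_univ j)]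
    have h0 : ∑ U : AvoidingSubset p j, (if j ∉ T ∧ j ≠ j ∧ insert j T = U.1 then
      (koszulSign T j : R) * α j else 0) * wedgeCoeff α U.1 S' = 0 :=
      Finset.sum_eq_zero fun U _ => by simp
    rw [h0, zero_add]
    refine Finset.sum_congr rfl fun k hk => ?_
    have hkj : k ≠ j := Finset.ne_of_mem_erase hk
    by_cases hkT : k ∈ T
    · simp [hkT]
    have hcard : (insert k T).card = p := by
      rw [Finset.card_insert_of_notMem hkT, hT, Finset.card_erase_of_mem hjS, hS]
      have : 0 < S.card := Finset.card_pos.2 ⟨j, hjS⟩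
      omega
    have hjk : j ∉ insert k T := by
      simp [hjT, hkj.symm]
    rw [Finset.sum_eq_single (⟨insert k T, hcard, hjk⟩ : AvoidingSubset p j)]
    · simp [hkT, hkj]
    · intro U _ hU
      have : ¬ insert k T = U.1 := fun h => hU (Subtype.ext h.symm)
      simp [this]
    · simp
  · refine ⟨fun U => if U.1 = S then 1 else 0, fun S' => ?_⟩
    rw [Finset.sum_eq_single (⟨S, hS, hjS⟩ : AvoidingSubset p j)]
    · simp
    · intro U _ hU
      have : ¬ U.1 = S := fun h => hU (Subtype.ext h)
      simp [this]
    · simp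

/-- The Koszul flattening of a rank one array factors through a space of dimension
`(n - 1).choose p`. -/
theorem koszulMatrix_rankOne_eq_mul {n p : ℕ} {ι κ R : Type*} [Field R] [CharZero R]
    (α : Fin n → R) (β : ι → R) (γ : κ → R) :
    ∃ (A : Matrix ({S : Finset (Fin n) // S.card = p} × ι) (Fin ((n - 1).choose p)) R)
      (B : Matrix (Fin ((n - 1).choose p)) (Finset (Fin n) × κ) R),
      koszulMatrix p (fun k u v => α k * β u * γ v) = A * B := by
  have hentry : ∀ S S' u v, wedgeCoeff (fun k => α k * β u * γ v) S S' =
      β u * wedgeCoeff α S S' * γ v := by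
    intro S S' u v
    simp only [wedgeCoeff, Finset.mul_sum, Finset.sum_mul]
    refine Finset.sum_congr rfl fun k _ => ?_
    split_ifs
    · ring
    · simp
  by_cases hα : ∃ j, α j ≠ 0
  · obtain ⟨j, hj⟩ := hα
    choose c hc using fun S : {S : Finset (Fin n) // S.card = p} =>
      exists_wedgeCoeff_eq_sum_avoiding α hj S.1 S.2
    have e : Fin ((n - 1).choose p) ≃ AvoidingSubset p j :=
      (Fintype.equivFinOfCardEq (card_avoidingSubset p j)).symm
    refine ⟨Matrix.of fun r i => β r.2 * c r.1 (e i),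
      Matrix.of fun i s => wedgeCoeff α (e i).1 s.1 * γ s.2, ?_⟩
    ext r s
    simp only [koszulMatrix, Matrix.of_apply, Matrix.mul_apply, hentry, hc]
    rw [Equiv.sum_comp e fun U => β r.2 * c r.1 U * (wedgeCoeff α U.1 s.1 * γ s.2)]
    rw [Finset.mul_sum, Finset.sum_mul]
    exact Finset.sum_congr rfl fun U _ => by ring
  · push Not at hα
    refine ⟨0, 0, ?_⟩
    ext r s
    simp [koszulMatrix, wedgeCoeff, hα]

theorem koszulMatrix_sum {n p : ℕ} {ι κ R σ : Type*} [CommRing R] [Fintype σ]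
    (t : σ → Fin n → ι → κ → R) :
    koszulMatrix p (fun k u v => ∑ i, t i k u v) = ∑ i, koszulMatrix p (t i) := by
  ext r s
  simp only [koszulMatrix, wedgeCoeff, Matrix.of_apply, Matrix.sum_apply]
  rw [Finset.sum_comm]
  refine Finset.sum_congr rfl fun k _ => ?_
  split_ifs
  · rw [Finset.mul_sum]
  · simp

/-- The Koszul flattening of an array of rank at most `m` has rank at most
`m * (n - 1).choose p`. -/
theorem rank_koszulMatrix_sum_le {n p m : ℕ} {ι κ R : Type*} [Field R] [CharZero R]
    [Fintype ι] [Fintype κ] (α : Fin m → Fin n → R) (β : Fin m → ι → R) (γ : Fin m → κ → R) :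
    (koszulMatrix p (fun k u v => ∑ i, α i k * β i u * γ i v)).rank ≤ m * (n - 1).choose p := by
  choose A B hAB using fun i => koszulMatrix_rankOne_eq_mul (p := p) (α i) (β i) (γ i)
  have h : koszulMatrix p (fun k u v => ∑ i, α i k * β i u * γ i v) =
      (Matrix.of fun r (x : Fin m × Fin ((n - 1).choose p)) => A x.1 r x.2) *
        (Matrix.of fun (x : Fin m × Fin ((n - 1).choose p)) s => B x.1 x.2 s) := by
    rw [koszulMatrix_sum (fun i k u v => α i k * β i u * γ i v)]
    ext r s
    simp [Matrix.sum_apply, hAB, Matrix.mul_apply, Fintype.sum_prod_type]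
  rw [h]
  refine (Matrix.rank_mul_le_left _ _).trans ((Matrix.rank_le_card_width _).trans ?_)
  simp

/-! ### Verified Gaussian elimination over `ZMod 3` on bit masks. -/

/-- Addition of vectors over `ZMod 3` that are stored as a pair of bit masks: the positions of the
entries `1` and the positions of the entries `-1`. -/
def tritAdd (v w : ℕ × ℕ) : ℕ × ℕ :=
  (Nat.xor (Nat.lor v.2 w.2) (Nat.xor (Nat.lor v.1 w.2) (Nat.lor w.1 v.2)),
    Nat.xor (Nat.lor v.1 w.1) (Nat.xor (Nat.lor v.1 w.2) (Nat.lor w.1 v.2)))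

/-- A pivot row, with entry `1` at the position whose bit mask is `mask`. -/
structure Pivot where
  row : ℕ × ℕ
  mask : ℕ

/-- Clear the entry of `v` at the pivot position of `P`. -/
def Pivot.clear (P : Pivot) (v : ℕ × ℕ) : ℕ × ℕ :=
  bif Nat.beq (Nat.land v.1 P.mask) 0 then
    bif Nat.beq (Nat.land v.2 P.mask) 0 then v else tritAdd v P.row
  else tritAdd v P.row.swap

/-- Reduce `v` by the pivots, oldest (last) first. -/
def reduceRow (l : List Pivot) (v : ℕ × ℕ) : ℕ × ℕ :=
  List.rec v (fun P _ w => P.clear w) l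

theorem reduceRow_cons (P : Pivot) (l : List Pivot) (v : ℕ × ℕ) :
    reduceRow (P :: l) v = P.clear (reduceRow l v) := rfl

/-- Reduce `v` by the pivots and add the result to the list of pivots if it is not zero. All vectors
are assumed to have at most `2048` entries. -/
def insertRow (v : ℕ × ℕ) (l : List Pivot) : List Pivot :=
  let w := reduceRow l v
  -- The gcd isolates the lowest nonzero position of `w`. For `w = 0` it is `2 ^ 2048`, both tests
  -- below find no entry there, and the row is dropped.
  let mask := Nat.gcd (Nat.pow 2 2048) (Nat.lor w.1 w.2)
  bif Nat.beq (Nat.land w.1 mask) 0 then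
    bif Nat.beq (Nat.land w.2 mask) 0 then l else ⟨w.swap, mask⟩ :: l
  else ⟨w, mask⟩ :: l

/-- Gaussian elimination. -/
def eliminate (rows : List (ℕ × ℕ)) : List Pivot :=
  rows.foldr insertRow []

/-- The positions where some row is not zero. -/
def supportMask (rows : List (ℕ × ℕ)) : ℕ :=
  rows.foldr (fun v m => Nat.lor (Nat.lor v.1 v.2) m) 0

/-- A lower bound for the rank of a block matrix over `ZMod 3`: Gaussian elimination in each block,
disregarding those whose support meets `used` or the support of an earlier block. -/
def blockRankBound : List (List (ℕ × ℕ)) → ℕ → ℕ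
  | [], _ => 0
  | rows :: blocks, used =>
    bif Nat.beq (Nat.land (supportMask rows) used) 0 then
      Nat.add (eliminate rows).length (blockRankBound blocks (Nat.lor (supportMask rows) used))
    else blockRankBound blocks used

/-- The vector over `ZMod 3` that a pair of bit masks stands for. -/
def trit (v : ℕ × ℕ) (j : ℕ) : ZMod 3 :=
  (if v.1.testBit j then 1 else 0) - (if v.2.testBit j then 1 else 0)

/-- The two bit masks are disjoint. -/
def ProperTrits (v : ℕ × ℕ) : Prop := ∀ j, v.1.testBit j = true → v.2.testBit j = false

theorem properTrits_zero : ProperTrits (0, 0) := fun j => by simp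

theorem trit_zero (j : ℕ) : trit (0, 0) j = 0 := by simp [trit]

theorem properTrits_of_land {v : ℕ × ℕ} (h : Nat.land v.1 v.2 = 0) : ProperTrits v := by
  intro j hj
  have h' : (v.1 &&& v.2).testBit j = false := by
    rw [show v.1 &&& v.2 = 0 from h]; simp
  simpa [Nat.testBit_and, hj] using h'

theorem testBit_tritAdd (v w : ℕ × ℕ) (j : ℕ) :
    (tritAdd v w).1.testBit j = ((v.2.testBit j || w.2.testBit j) ^^
      ((v.1.testBit j || w.2.testBit j) ^^ (w.1.testBit j || v.2.testBit j))) ∧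
    (tritAdd v w).2.testBit j = ((v.1.testBit j || w.1.testBit j) ^^
      ((v.1.testBit j || w.2.testBit j) ^^ (w.1.testBit j || v.2.testBit j))) := by
  constructor
  · change ((v.2 ||| w.2) ^^^ ((v.1 ||| w.2) ^^^ (w.1 ||| v.2))).testBit j = _
    simp only [Nat.testBit_xor, Nat.testBit_or]
  · change ((v.1 ||| w.1) ^^^ ((v.1 ||| w.2) ^^^ (w.1 ||| v.2))).testBit j = _
    simp only [Nat.testBit_xor, Nat.testBit_or]

theorem ProperTrits.add {v w : ℕ × ℕ} (hv : ProperTrits v) (hw : ProperTrits w) :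
    ProperTrits (tritAdd v w) := by
  intro j
  have h1 := hv j
  have h2 := hw j
  rw [(testBit_tritAdd v w j).1, (testBit_tritAdd v w j).2]
  revert h1 h2
  generalize v.1.testBit j = a
  generalize v.2.testBit j = b
  generalize w.1.testBit j = c
  generalize w.2.testBit j = d
  revert a b c d
  decide

theorem trit_tritAdd {v w : ℕ × ℕ} (hv : ProperTrits v) (hw : ProperTrits w) (j : ℕ) :
    trit (tritAdd v w) j = trit v j + trit w j := by
  have h1 := hv j
  have h2 := hw j
  rw [trit, trit, trit, (testBit_tritAdd v w j).1, (testBit_tritAdd v w j).2]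
  revert h1 h2
  generalize v.1.testBit j = a
  generalize v.2.testBit j = b
  generalize w.1.testBit j = c
  generalize w.2.testBit j = d
  revert a b c d
  decide

theorem ProperTrits.swap {v : ℕ × ℕ} (hv : ProperTrits v) : ProperTrits v.swap := by
  intro j hj
  by_contra h
  have h' : v.1.testBit j = true := by simpa using h
  have h'' : v.2.testBit j = true := hj
  rw [hv j h'] at h''
  exact Bool.false_ne_true h''

theorem trit_swap (v : ℕ × ℕ) (j : ℕ) : trit v.swap j = -trit v j := by
  simp [trit]

theorem beq_land_two_pow (a l : ℕ) : Nat.beq (Nat.land a (2 ^ l)) 0 = !a.testBit l := by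
  have h : Nat.land a (2 ^ l) = (a.testBit l).toNat * 2 ^ l := Nat.and_two_pow a l
  rw [h]
  cases a.testBit l
  · simp
  · exact Bool.eq_false_iff.2 fun h' => by simpa using Nat.eq_of_beq_eq_true h'

/-- The pivot position. -/
def Pivot.lead (P : Pivot) : ℕ := Nat.log2 P.mask

/-- The pivot row has entry `1` at the pivot position. -/
structure Pivot.Valid (P : Pivot) : Prop where
  proper : ProperTrits P.row
  mask_eq : P.mask = 2 ^ P.lead
  trit_lead : trit P.row P.lead = 1

theorem Pivot.Valid.properTrits_clear {P : Pivot} (hP : P.Valid) {v : ℕ × ℕ}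
    (hv : ProperTrits v) : ProperTrits (P.clear v) := by
  unfold Pivot.clear
  cases Nat.beq (Nat.land v.1 P.mask) 0
  · exact hv.add hP.proper.swap
  · cases Nat.beq (Nat.land v.2 P.mask) 0
    · exact hv.add hP.proper
    · exact hv

theorem Pivot.Valid.trit_clear {P : Pivot} (hP : P.Valid) {v : ℕ × ℕ} (hv : ProperTrits v)
    (j : ℕ) : trit (P.clear v) j = trit v j - trit v P.lead * trit P.row j := by
  unfold Pivot.clear
  rw [hP.mask_eq, beq_land_two_pow, beq_land_two_pow]
  have h := hv P.lead
  have hl : trit v P.lead = (if v.1.testBit P.lead then 1 else 0) -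
    (if v.2.testBit P.lead then 1 else 0) := rfl
  rw [hl]
  cases h1 : v.1.testBit P.lead
  · cases h2 : v.2.testBit P.lead
    · simp
    · simp [trit_tritAdd hv hP.proper]
  · rw [h1] at h
    simp [trit_tritAdd hv hP.proper.swap, trit_swap, h rfl, sub_eq_add_neg]

/-- A list of pivots, newest first, such that every row vanishes at all older pivot positions and
belongs to the row space `W`. -/
structure IsEchelon (W : Submodule (ZMod 3) (ℕ → ZMod 3)) (l : List Pivot) : Prop where
  valid : ∀ P ∈ l, P.Valid
  mem : ∀ P ∈ l, trit P.row ∈ W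
  pairwise : l.Pairwise fun P Q => trit P.row Q.lead = 0

/-- Reducing by the oldest pivot first is what makes one pass enough: a newer pivot row vanishes at
all older pivot positions, so subtracting it preserves the zeros already made. -/
theorem IsEchelon.reduceRow {W : Submodule (ZMod 3) (ℕ → ZMod 3)} {l : List Pivot}
    (hl : IsEchelon W l) {v : ℕ × ℕ} (hv : ProperTrits v) (hvW : trit v ∈ W) :
    ProperTrits (_root_.reduceRow l v) ∧ trit (_root_.reduceRow l v) ∈ W ∧
      ∀ Q ∈ l, trit (_root_.reduceRow l v) Q.lead = 0 := by
  induction l with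
  | nil => exact ⟨hv, hvW, by simp⟩
  | cons P l ih =>
    obtain ⟨h1, h2, h3⟩ := ih ⟨fun Q hQ => hl.valid Q (List.mem_cons_of_mem _ hQ),
      fun Q hQ => hl.mem Q (List.mem_cons_of_mem _ hQ), (List.pairwise_cons.1 hl.pairwise).2⟩
    have hP := hl.valid P List.mem_cons_self
    rw [reduceRow_cons]
    set w := _root_.reduceRow l v
    refine ⟨hP.properTrits_clear h1, ?_, ?_⟩
    · have : trit (P.clear w) = trit w - trit w P.lead • trit P.row :=
        funext fun j => by simp [hP.trit_clear h1]
      rw [this]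
      exact W.sub_mem h2 (W.smul_mem _ (hl.mem P List.mem_cons_self))
    · intro Q hQ
      rw [hP.trit_clear h1]
      rcases List.mem_cons.1 hQ with rfl | hQ
      · simp [hP.trit_lead]
      · simp [h3 Q hQ, (List.pairwise_cons.1 hl.pairwise).1 Q hQ]

theorem IsEchelon.cons {W : Submodule (ZMod 3) (ℕ → ZMod 3)} {l : List Pivot}
    (hl : IsEchelon W l) {w : ℕ × ℕ} {m : ℕ} (hw : ProperTrits w) (hwW : trit w ∈ W)
    (h0 : ∀ Q ∈ l, trit w Q.lead = 0) (hm : w.1.testBit m = true) :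
    IsEchelon W (⟨w, 2 ^ m⟩ :: l) := by
  have hlead : Pivot.lead ⟨w, 2 ^ m⟩ = m := Nat.log2_two_pow
  refine ⟨?_, ?_, List.pairwise_cons.2 ⟨h0, hl.pairwise⟩⟩
  · intro P hP
    rcases List.mem_cons.1 hP with rfl | hP
    · refine ⟨hw, by rw [hlead], ?_⟩
      rw [hlead]
      simp [trit, hm, hw m hm]
    · exact hl.valid P hP
  · intro P hP
    rcases List.mem_cons.1 hP with rfl | hP
    · exact hwW
    · exact hl.mem P hP

set_option exponentiation.threshold 3000 in
theorem IsEchelon.insertRow {W : Submodule (ZMod 3) (ℕ → ZMod 3)} {l : List Pivot}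
    (hl : IsEchelon W l) {v : ℕ × ℕ} (hv : ProperTrits v) (hvW : trit v ∈ W) :
    IsEchelon W (insertRow v l) := by
  obtain ⟨h1, h2, h3⟩ := hl.reduceRow hv hvW
  unfold _root_.insertRow
  set w := _root_.reduceRow l v
  -- Only that the mask is a power of two matters here. Minimality of its position is never used,
  -- and dropping a row only weakens the bound.
  obtain ⟨m, -, hm⟩ := (Nat.dvd_prime_pow Nat.prime_two).1
    (Nat.gcd_dvd_left (2 ^ 2048) (Nat.lor w.1 w.2))
  have hm' : Nat.gcd (Nat.pow 2 2048) (Nat.lor w.1 w.2) = 2 ^ m := hm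
  simp only [hm', beq_land_two_pow]
  cases hb1 : w.1.testBit m
  · cases hb2 : w.2.testBit m
    · exact hl
    · refine hl.cons h1.swap ?_ (fun Q hQ => ?_) hb2
      · have : trit w.swap = -trit w := funext fun j => trit_swap w j
        rw [this]
        exact W.neg_mem h2
      · rw [trit_swap, h3 Q hQ, neg_zero]
  · exact hl.cons h1 h2 h3 hb1

theorem isEchelon_eliminate {W : Submodule (ZMod 3) (ℕ → ZMod 3)} (rows : List (ℕ × ℕ))
    (h : ∀ v ∈ rows, ProperTrits v ∧ trit v ∈ W) : IsEchelon W (eliminate rows) := by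
  induction rows with
  | nil => exact ⟨by simp [eliminate], by simp [eliminate], List.Pairwise.nil⟩
  | cons v rows ih =>
    exact (ih fun w hw => h w (List.mem_cons_of_mem _ hw)).insertRow
      (h v List.mem_cons_self).1 (h v List.mem_cons_self).2

theorem trit_eq_zero_of_supportMask {rows : List (ℕ × ℕ)} {v : ℕ × ℕ} (hv : v ∈ rows) {j : ℕ}
    (hj : (supportMask rows).testBit j = false) : trit v j = 0 := by
  induction rows with
  | nil => simp at hv
  | cons w rows ih =>
    have hs : supportMask (w :: rows) = (w.1 ||| w.2) ||| supportMask rows := rfl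
    rw [hs, Nat.testBit_or, Nat.testBit_or, Bool.or_eq_false_iff, Bool.or_eq_false_iff] at hj
    rcases List.mem_cons.1 hv with rfl | hv
    · simp [trit, hj.1.1, hj.1.2]
    · exact ih hv hj.2

/-- Pivots of an accepted block can be put before the older ones: rows spanned by the block vanish
off its support, hence at all older pivot positions, which lie in `used`. Disjointness is tested at
run time, so soundness does not depend on the grading that suggested the blocks. -/
theorem exists_isEchelon_blockRankBound {W : Submodule (ZMod 3) (ℕ → ZMod 3)}
    (blocks : List (List (ℕ × ℕ))) (hW : ∀ rows ∈ blocks, ∀ v ∈ rows, ProperTrits v ∧ trit v ∈ W)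
    (used : ℕ) (older : List Pivot) (holder : IsEchelon W older)
    (hused : ∀ P ∈ older, used.testBit P.lead = true) :
    ∃ l, IsEchelon W l ∧ l.length = blockRankBound blocks used + older.length := by
  induction blocks generalizing used older with
  | nil => exact ⟨older, holder, by simp [blockRankBound]⟩
  | cons rows blocks ih =>
    have ih' := ih fun r hr => hW r (List.mem_cons_of_mem _ hr)
    rw [blockRankBound]
    cases hb : Nat.beq (Nat.land (supportMask rows) used) 0
    · exact ih' used older holder hused
    · have hdisj : supportMask rows &&& used = 0 := Nat.eq_of_beq_eq_true hb
      have hdisj' : ∀ j, used.testBit j = true → (supportMask rows).testBit j = false := by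
        intro j hj
        have : (supportMask rows &&& used).testBit j = false := by rw [hdisj]; simp
        simpa [Nat.testBit_and, hj] using this
      set V : Submodule (ZMod 3) (ℕ → ZMod 3) := Submodule.span (ZMod 3) {f | ∃ v ∈ rows, trit v = f}
      have hE : IsEchelon V (eliminate rows) := isEchelon_eliminate rows fun v hv =>
        ⟨(hW rows List.mem_cons_self v hv).1, Submodule.subset_span ⟨v, hv, rfl⟩⟩
      have hVW : V ≤ W := Submodule.span_le.2 fun f ⟨v, hv, hf⟩ =>
        hf ▸ (hW rows List.mem_cons_self v hv).2
      have hV0 : ∀ f ∈ V, ∀ j, (supportMask rows).testBit j = false → f j = 0 := by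
        intro f hf j hj
        induction hf using Submodule.span_induction with
        | mem f hf => obtain ⟨v, hv, rfl⟩ := hf; exact trit_eq_zero_of_supportMask hv hj
        | zero => rfl
        | add f g _ _ h1 h2 => simp [h1, h2]
        | smul c f _ h => simp [h]
      obtain ⟨l, hl, hlen⟩ := ih' (supportMask rows ||| used) (eliminate rows ++ older)
        ⟨fun P hP => (List.mem_append.1 hP).elim (hE.valid P) (holder.valid P),
          fun P hP => (List.mem_append.1 hP).elim (fun h => hVW (hE.mem P h)) (holder.mem P),
          List.pairwise_append.2 ⟨hE.pairwise, holder.pairwise, fun P hP Q hQ =>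
            hV0 _ (hE.mem P hP) _ (hdisj' _ (hused Q hQ))⟩⟩ (by
          intro P hP
          rw [Nat.testBit_or]
          rcases List.mem_append.1 hP with hP | hP
          · have : (supportMask rows).testBit P.lead = true := by
              by_contra hcon
              have := hV0 _ (hE.mem P hP) P.lead (by simpa using hcon)
              rw [(hE.valid P hP).trit_lead] at this
              exact one_ne_zero this
            simp [this]
          · simp [hused P hP])
      refine ⟨l, hl, ?_⟩
      have heq : (bif true then
          Nat.add (eliminate rows).length (blockRankBound blocks (Nat.lor (supportMask rows) used))
          else blockRankBound blocks used) =
          (eliminate rows).length + blockRankBound blocks (supportMask rows ||| used) := rfl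
      rw [heq, hlen, List.length_append]
      omega

/-- If the rows in `blocks` are images of rows of an integer matrix `K` under a relabelling `pos` of
the columns, then `K` has a nonsingular compression of size `blockRankBound blocks 0`. -/
theorem exists_det_mul_mul_ne_zero {ι κ : Type*} [Fintype ι] [Fintype κ] (K : Matrix ι κ ℤ)
    (pos : κ → ℕ) (blocks : List (List (ℕ × ℕ)))
    (h : ∀ rows ∈ blocks, ∀ v ∈ rows, ProperTrits v ∧
      ∃ i, ∀ j, trit v j = ∑ c, if pos c = j then (K i c : ZMod 3) else 0) :
    ∃ (L : Matrix (Fin (blockRankBound blocks 0)) ι ℤ)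
      (N : Matrix κ (Fin (blockRankBound blocks 0)) ℤ), (L * K * N).det ≠ 0 := by
  set f : ι → ℕ → ZMod 3 := fun i j => ∑ c, if pos c = j then (K i c : ZMod 3) else 0
  obtain ⟨l, hl, hlen⟩ := exists_isEchelon_blockRankBound
    (W := Submodule.span (ZMod 3) (Set.range f)) blocks (fun rows hr v hv => by
      obtain ⟨h1, i, h2⟩ := h rows hr v hv
      exact ⟨h1, Submodule.subset_span ⟨i, (funext h2).symm⟩⟩) 0 []
    ⟨by simp, by simp, List.Pairwise.nil⟩ (by simp)
  rw [List.length_nil, add_zero] at hlen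
  rw [← hlen]
  have hmem : ∀ a : Fin l.length, ∃ c : ι → ZMod 3, ∑ i, c i • f i = trit l[a].row := fun a =>
    (Submodule.mem_span_range_iff_exists_fun _).1 (hl.mem _ (List.getElem_mem _))
  choose c hc using hmem
  -- `L` lifts the coefficients that express the pivot rows, and `N` adds up the columns sent to
  -- each pivot position, so `pos` need not be injective. Modulo 3 the product is unitriangular.
  refine ⟨Matrix.of fun a i => ((c a i).val : ℤ),
    Matrix.of fun s b => if pos s = l[b].lead then 1 else 0, fun hdet => ?_⟩
  have hB : (Int.castRingHom (ZMod 3)).mapMatrix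
      ((Matrix.of fun a i => ((c a i).val : ℤ)) * K *
        Matrix.of fun s (b : Fin l.length) => if pos s = l[b].lead then (1 : ℤ) else 0) =
      Matrix.of fun (a b : Fin l.length) => trit l[a].row l[b].lead := by
    ext a b
    have hca := congrFun (hc a) l[b].lead
    rw [Finset.sum_apply] at hca
    rw [RingHom.mapMatrix_apply, Matrix.map_apply, Matrix.mul_assoc, Matrix.mul_apply, map_sum,
      Matrix.of_apply, ← hca]
    refine Finset.sum_congr rfl fun i _ => ?_
    rw [map_mul, Matrix.mul_apply, map_sum, Pi.smul_apply, smul_eq_mul]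
    congr 1
    · simp
    · refine Finset.sum_congr rfl fun s _ => ?_
      rw [map_mul, Matrix.of_apply]
      split_ifs <;> simp
  have hdet' := congrArg (Int.castRingHom (ZMod 3)) hdet
  rw [RingHom.map_det, hB, map_zero, Matrix.det_of_isLowerTriangular] at hdet'
  · refine one_ne_zero (α := ZMod 3) ?_
    rw [← hdet']
    exact (Finset.prod_eq_one fun a _ => (hl.valid _ (List.getElem_mem _)).trit_lead).symm
  · intro a b hab
    exact List.pairwise_iff_getElem.1 hl.pairwise a b a.2 b.2 hab

/-! ### The explicit Koszul matrix of nine generators and its encoding. -/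

/-- The number of binary digits `1` of `n` among the first `m`. -/
def bitCount (n m : ℕ) : ℕ :=
  Nat.rec 0 (fun k c => bif Nat.beq (Nat.land n (2 ^ k)) 0 then c else Nat.succ c) m

/-- The sum of the positions of the binary digits `1` of `n` among the first `m`. -/
def bitSum (n m : ℕ) : ℕ :=
  Nat.rec 0 (fun k c => bif Nat.beq (Nat.land n (2 ^ k)) 0 then c else Nat.add c k) m

/-- The nonzero entries `(i, j, sign)` of the matrices `generator k`. -/
def generatorEntries : List (List (ℕ × ℕ × Bool)) :=
  [[(0, 2, true)], [(3, 2, true)], [(0, 1, true), (1, 2, false)], [(0, 3, true), (3, 1, true)],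
    [(0, 0, false), (3, 3, true)], [(1, 3, true)], [(1, 0, true), (2, 1, true)], [(2, 3, true)],
    [(2, 0, true)]]

/-- Nine traceless matrices whose lower left entry is zero. The matrix `generator k` is homogeneous
of degree `k - 4` for the grading by `deg E_ij = d_i - d_j` with `d = (0, 2, 4, 1)`. -/
def generator (k : Fin 9) : Matrix (Fin 4) (Fin 4) ℤ :=
  Matrix.of fun i j => ((generatorEntries.getD k []).map fun e =>
    if e.1 = (i : ℕ) ∧ e.2.1 = (j : ℕ) then (if e.2.2 then 1 else -1) else 0).sum

/-- The entry at `v` of the commutator of `X` and the matrix unit at `u`. -/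
def unitCommutator {R : Type*} [CommRing R] (X : Matrix (Fin 4) (Fin 4) R)
    (u v : Fin 4 × Fin 4) : R :=
  (if u.2 = v.2 then X v.1 u.1 else 0) - (if u.1 = v.1 then X u.2 v.2 else 0)

/-- The number of a matrix position. -/
def positionCode (u : Fin 4 × Fin 4) : ℕ := 4 * u.1 + u.2

/-- The commutator `± [E_ab, E_ij]` as a pair of bit masks. -/
def unitCommutatorTrits (a b i j : ℕ) (s : Bool) : ℕ × ℕ :=
  let w := tritAdd (bif Nat.beq b i then 2 ^ (4 * a + j) else 0, 0)
    (0, bif Nat.beq j a then 2 ^ (4 * i + b) else 0)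
  bif s then w else w.swap

/-- All commutators of generators with matrix units, as pairs of `16`-bit masks. -/
def commutatorTable : ℕ :=
  generatorEntries.foldr (fun l t => (List.range 16).foldr (fun u t' =>
    let w := l.foldr (fun e w =>
      tritAdd (unitCommutatorTrits e.1 e.2.1 (u / 4) (u % 4) e.2.2) w) (0, 0)
    Nat.add (Nat.add w.1 (Nat.shiftLeft w.2 16)) (Nat.shiftLeft t' 32)) t) 0

/-- The commutator of `generator k` with the matrix unit number `u`. -/
def commutatorTrits (k u : ℕ) : ℕ × ℕ :=
  (Nat.land (Nat.shiftRight commutatorTable (512 * k + 32 * u)) 65535,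
   Nat.land (Nat.shiftRight commutatorTable (512 * k + 32 * u + 16)) 65535)

/-- A table that numbers the subsets of `Fin 9` with five elements. -/
def subsetIndexTable : ℕ :=
  -- There are 126 such subsets, so a number fits in 8 bits; all other subsets get the number 0.
  ((List.range 512).foldr (fun n s => bif Nat.beq (bitCount n 9) 5 then
    (Nat.add (Nat.shiftLeft s.1 8) s.2, Nat.succ s.2) else (Nat.shiftLeft s.1 8, s.2))
    ((0 : ℕ), (0 : ℕ))).1

/-- The number of a subset of `Fin 9` with five elements that is given by its bit mask. -/
def subsetIndex (n : ℕ) : ℕ := Nat.land (Nat.shiftRight subsetIndexTable (8 * n)) 255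

/-- Multiply all positions by a shift. -/
def shiftTrits (w : ℕ × ℕ) (s : ℕ) : ℕ × ℕ := (Nat.shiftLeft w.1 s, Nat.shiftLeft w.2 s)

/-- The contribution of `generator k` to the row of the Koszul matrix at the subset with bit mask
`n` and the matrix unit number `u`. -/
def koszulTermTrits (n u k : ℕ) : ℕ × ℕ :=
  let w := shiftTrits (commutatorTrits k u) (16 * subsetIndex (n + 2 ^ k))
  bif Nat.beq (Nat.land (bitCount n k) 1) 0 then w else w.swap

/-- The row of the Koszul matrix at the subset with bit mask `n` and the matrix unit number `u`. -/
def koszulRowTrits (n u : ℕ) : ℕ × ℕ :=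
  [0, 1, 2, 3, 4, 5, 6, 7, 8].foldr (fun k v =>
    bif Nat.beq (Nat.land n (2 ^ k)) 0 then tritAdd (koszulTermTrits n u k) v else v) (0, 0)

/-- The bit masks of the subsets of `Fin 9` with four elements. -/
def fourSubsets : List ℕ := (List.range 512).filter fun n => Nat.beq (bitCount n 9) 4

/-- The matrix units of degree `e - 5`. -/
def unitsOfDegree (e : ℕ) : List ℕ :=
  [[], [2], [14], [1, 6], [3, 13], [0, 5, 10], [7, 12], [4, 9], [11], [8]].getD e []

/-- The rows of the Koszul matrix, grouped by degree. -/
def koszulBlocks : List (List (ℕ × ℕ)) :=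
  -- The degree of the matrix unit minus the total degree of the subset is the same for a row and
  -- for every column where it is nonzero. Here it equals `d - 14`, and its range is from -14 to 14.
  -- When the subtraction of 25 truncates, the result 0 selects an empty list, since no matrix unit
  -- has degree -5.
  (List.range 29).map fun d => fourSubsets.flatMap fun n =>
    (unitsOfDegree (d + bitSum n 9 - 25)).map (koszulRowTrits n)

/-- The threshold is one more than `26 * (8.choose 4) = 1820`. -/
theorem le_blockRankBound_koszulBlocks : 1821 ≤ blockRankBound koszulBlocks 0 := by
  decide +kernel

theorem commutatorTrits_spec : ∀ (k : Fin 9) (u : Fin 4 × Fin 4),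
    Nat.land (commutatorTrits k (positionCode u)).1 (commutatorTrits k (positionCode u)).2 = 0 ∧
    ∀ v : Fin 4 × Fin 4, trit (commutatorTrits k (positionCode u)) (positionCode v) =
      ((unitCommutator (generator k) u v : ℤ) : ZMod 3) := by
  decide +kernel

/-- The bit mask of a subset of `Fin 9`. -/
def subsetCode (S : Finset (Fin 9)) : ℕ := ∑ k ∈ S, 2 ^ (k : ℕ)

/-- The subset of `Fin 9` with a given bit mask. -/
def subsetOfCode (n : ℕ) : Finset (Fin 9) := Finset.univ.filter fun k => n.testBit k = true

theorem fourSubsets_spec : ∀ n ∈ fourSubsets, (subsetOfCode n).card = 4 ∧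
    subsetCode (subsetOfCode n) = n ∧ ∀ k : Fin 9, koszulSign (subsetOfCode n) k =
      if Nat.beq (Nat.land (bitCount n k) 1) 0 then 1 else -1 := by
  decide +kernel

theorem positionCode_injective : Function.Injective positionCode := by
  unfold Function.Injective
  decide +kernel

theorem exists_positionCode_eq {m : ℕ} (hm : m < 16) : ∃ u, positionCode u = m := by
  refine ⟨(⟨m / 4, by omega⟩, ⟨m % 4, by omega⟩), ?_⟩
  simp only [positionCode]
  omega

theorem positionCode_lt (u : Fin 4 × Fin 4) : positionCode u < 16 := by
  have h1 := u.1.isLt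
  have h2 := u.2.isLt
  simp only [positionCode]
  omega

theorem lt_of_mem_unitsOfDegree {e u : ℕ} (hu : u ∈ unitsOfDegree e) : u < 16 := by
  unfold unitsOfDegree at hu
  rcases lt_or_ge e 10 with he | he
  · interval_cases e <;> simp at hu <;> omega
  · rw [List.getD_eq_default _ _ (by simpa using he)] at hu
    simp at hu

theorem trit_shiftTrits (w : ℕ × ℕ) (s j : ℕ) :
    trit (shiftTrits w s) j = if s ≤ j then trit w (j - s) else 0 := by
  have h : ∀ a : ℕ, (Nat.shiftLeft a s).testBit j = (decide (s ≤ j) && a.testBit (j - s)) :=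
    fun a => Nat.testBit_shiftLeft a
  simp only [trit, shiftTrits, h]
  by_cases hs : s ≤ j <;> simp [hs]

theorem ProperTrits.shift {w : ℕ × ℕ} (hw : ProperTrits w) (s : ℕ) :
    ProperTrits (shiftTrits w s) := by
  intro j
  have h : ∀ a : ℕ, (Nat.shiftLeft a s).testBit j = (decide (s ≤ j) && a.testBit (j - s)) :=
    fun a => Nat.testBit_shiftLeft a
  simp only [shiftTrits, h]
  by_cases hs : s ≤ j
  · simpa [hs] using hw (j - s)
  · simp [hs]

theorem properTrits_commutatorTrits (k : Fin 9) (u : Fin 4 × Fin 4) :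
    ProperTrits (commutatorTrits k (positionCode u)) :=
  properTrits_of_land (commutatorTrits_spec k u).1

theorem trit_commutatorTrits_of_le (k u : ℕ) {m : ℕ} (hm : 16 ≤ m) :
    trit (commutatorTrits k u) m = 0 := by
  have h : ∀ a : ℕ, (Nat.land a 65535).testBit m = false := by
    intro a
    have hle : Nat.land a 65535 ≤ 65535 := Nat.and_le_right
    refine Nat.testBit_lt_two_pow (lt_of_lt_of_le (Nat.lt_succ_of_le hle) ?_)
    exact (by norm_num : (65535 + 1 : ℕ) = 2 ^ 16).le.trans (Nat.pow_le_pow_right (by norm_num) hm)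
  simp only [trit, commutatorTrits, h]
  simp

theorem trit_shiftTrits_commutatorTrits (k : Fin 9) (u : Fin 4 × Fin 4) (s j : ℕ) :
    trit (shiftTrits (commutatorTrits k (positionCode u)) s) j =
      ∑ v, if s + positionCode v = j then
        ((unitCommutator (generator k) u v : ℤ) : ZMod 3) else 0 := by
  rw [trit_shiftTrits]
  split_ifs with hs
  · rcases lt_or_ge (j - s) 16 with hm | hm
    · obtain ⟨v, hv⟩ := exists_positionCode_eq hm
      rw [Finset.sum_eq_single v, if_pos (by omega), ← hv, (commutatorTrits_spec k u).2 v]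
      · intro v' _ hv'
        exact if_neg fun h => hv' (positionCode_injective (by omega))
      · simp
    · rw [trit_commutatorTrits_of_le _ _ hm]
      refine (Finset.sum_eq_zero fun v _ => if_neg fun h => ?_).symm
      have := positionCode_lt v
      omega
  · exact (Finset.sum_eq_zero fun v _ => if_neg fun h => hs (by omega)).symm

theorem properTrits_koszulTermTrits (n : ℕ) (u : Fin 4 × Fin 4) (k : Fin 9) :
    ProperTrits (koszulTermTrits n (positionCode u) k) := by
  unfold koszulTermTrits
  have h := (properTrits_commutatorTrits k u).shift (16 * subsetIndex (n + 2 ^ (k : ℕ)))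
  cases Nat.beq (Nat.land (bitCount n k) 1) 0
  · exact h.swap
  · exact h

theorem trit_koszulTermTrits {n : ℕ} (hn : n ∈ fourSubsets) (u : Fin 4 × Fin 4) (k : Fin 9)
    (j : ℕ) : trit (koszulTermTrits n (positionCode u) k) j =
      ∑ v, if 16 * subsetIndex (n + 2 ^ (k : ℕ)) + positionCode v = j then
        ((koszulSign (subsetOfCode n) k * unitCommutator (generator k) u v : ℤ) : ZMod 3)
        else 0 := by
  rw [((fourSubsets_spec n hn).2.2 k)]
  have h := trit_shiftTrits_commutatorTrits k u (16 * subsetIndex (n + 2 ^ (k : ℕ))) j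
  unfold koszulTermTrits
  cases Nat.beq (Nat.land (bitCount n k) 1) 0
  · change trit (Prod.swap _) j = _
    rw [trit_swap, h, ← Finset.sum_neg_distrib]
    refine Finset.sum_congr rfl fun v _ => ?_
    split_ifs <;> simp_all
  · simpa using h

theorem properTrits_koszulRowTrits_and_trit (n : ℕ) (u : Fin 4 × Fin 4) :
    ProperTrits (koszulRowTrits n (positionCode u)) ∧
    ∀ j, trit (koszulRowTrits n (positionCode u)) j =
      ∑ k : Fin 9, if k ∈ subsetOfCode n then 0 else
        trit (koszulTermTrits n (positionCode u) k) j := by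
  have key : ∀ l : List (Fin 9),
      ProperTrits (l.foldr (fun (k : Fin 9) v => bif Nat.beq (Nat.land n (2 ^ (k : ℕ))) 0 then
        tritAdd (koszulTermTrits n (positionCode u) k) v else v) (0, 0)) ∧
      ∀ j, trit (l.foldr (fun (k : Fin 9) v => bif Nat.beq (Nat.land n (2 ^ (k : ℕ))) 0 then
        tritAdd (koszulTermTrits n (positionCode u) k) v else v) (0, 0)) j =
        (l.map fun k => if k ∈ subsetOfCode n then 0 else
          trit (koszulTermTrits n (positionCode u) k) j).sum := by
    intro l
    induction l with
    | nil => exact ⟨properTrits_zero, fun j => by simp [trit_zero]⟩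
    | cons k l ih =>
      have hk : k ∈ subsetOfCode n ↔ n.testBit k = true := by simp [subsetOfCode]
      rw [List.foldr_cons, beq_land_two_pow]
      cases hb : n.testBit k
      · have hp := properTrits_koszulTermTrits n u k
        refine ⟨hp.add ih.1, fun j => ?_⟩
        change trit (tritAdd _ _) j = _
        rw [trit_tritAdd hp ih.1, ih.2, List.map_cons, List.sum_cons, if_neg (by simp [hk, hb])]
      · refine ⟨ih.1, fun j => ?_⟩
        rw [List.map_cons, List.sum_cons, if_pos (by simp [hk, hb]), zero_add]
        exact ih.2 j
  have h := key (List.finRange 9)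
  refine ⟨h.1, fun j => (h.2 j).trans ?_⟩
  rw [← List.sum_ofFn, List.ofFn_eq_map]

/-- The column labels of the encoded Koszul matrix. -/
def columnPosition (c : Finset (Fin 9) × (Fin 4 × Fin 4)) : ℕ :=
  16 * subsetIndex (subsetCode c.1) + positionCode c.2

/-- This ties the bit masks used in the elimination to `koszulMatrix`, in the form required by
`exists_det_mul_mul_ne_zero`: for each `k ∉ S` only the columns at `insert k S` contribute. -/
theorem trit_koszulRowTrits {n : ℕ} (hn : n ∈ fourSubsets) (u : Fin 4 × Fin 4) (j : ℕ) :
    trit (koszulRowTrits n (positionCode u)) j =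
      ∑ c, if columnPosition c = j then ((koszulMatrix 4
        (fun k u v => unitCommutator (generator k) u v)
          (⟨subsetOfCode n, (fourSubsets_spec n hn).1⟩, u) c : ℤ) : ZMod 3) else 0 := by
  have hcode := (fourSubsets_spec n hn).2.1
  set S := subsetOfCode n with hS
  have hexp : ∀ c : Finset (Fin 9) × (Fin 4 × Fin 4), (if columnPosition c = j then
      ((koszulMatrix 4 (fun k u v => unitCommutator (generator k) u v)
        (⟨S, (fourSubsets_spec n hn).1⟩, u) c : ℤ) : ZMod 3) else 0) =
      ∑ k, if columnPosition c = j ∧ k ∉ S ∧ insert k S = c.1 then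
        ((koszulSign S k * unitCommutator (generator k) u c.2 : ℤ) : ZMod 3) else 0 := by
    intro c
    by_cases hc : columnPosition c = j
    · simp only [hc, if_true, true_and, koszulMatrix, wedgeCoeff, Matrix.of_apply, Int.cast_sum]
      refine Finset.sum_congr rfl fun k _ => ?_
      split_ifs <;> simp
    · simp [hc]
  rw [(properTrits_koszulRowTrits_and_trit n u).2, Finset.sum_congr rfl fun c _ => hexp c,
    Finset.sum_comm]
  refine Finset.sum_congr rfl fun k _ => ?_
  rw [← hS]
  by_cases hk : k ∈ S
  · simp [hk]
  rw [if_neg hk, trit_koszulTermTrits hn]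
  symm
  rw [Fintype.sum_prod_type, Finset.sum_eq_single (insert k S)]
  · have hins : subsetCode (insert k S) = n + 2 ^ (k : ℕ) := by
      rw [subsetCode, Finset.sum_insert hk, ← subsetCode, hcode, add_comm]
    simp only [columnPosition, hins, hk, not_false_eq_true, and_true]
    rfl
  · intro S' _ hS'
    refine Finset.sum_eq_zero fun v _ => if_neg fun h => hS' h.2.2.symm
  · simp

/-- The Koszul matrix of the generators has rank at least `1821`. -/
theorem exists_det_koszulMatrix_generator_ne_zero :
    ∃ r, 1821 ≤ r ∧ ∃ (L : Matrix (Fin r) ({S : Finset (Fin 9) // S.card = 4} × (Fin 4 × Fin 4)) ℤ)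
      (N : Matrix (Finset (Fin 9) × (Fin 4 × Fin 4)) (Fin r) ℤ),
      (L * koszulMatrix 4 (fun k u v => unitCommutator (generator k) u v) * N).det ≠ 0 := by
  refine ⟨_, le_blockRankBound_koszulBlocks, exists_det_mul_mul_ne_zero _ columnPosition _ ?_⟩
  intro rows hrows v hv
  obtain ⟨d, -, rfl⟩ := List.mem_map.1 hrows
  obtain ⟨n, hn, hv⟩ := List.mem_flatMap.1 hv
  obtain ⟨m, hm, rfl⟩ := List.mem_map.1 hv
  obtain ⟨u, rfl⟩ := exists_positionCode_eq (lt_of_mem_unitsOfDegree hm)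
  exact ⟨(properTrits_koszulRowTrits_and_trit n u).1, _, trit_koszulRowTrits hn u⟩

/-! ### Attaining rank and border rank, and limits under linear functionals. -/

section Tensor

variable {A B C : Type*} [AddCommGroup A] [Module ℂ A] [AddCommGroup B] [Module ℂ B]
  [AddCommGroup C] [Module ℂ C]

theorem exists_eq_sum_tmul (T : A ⊗[ℂ] (B ⊗[ℂ] C)) :
    ∃ (r : ℕ) (a : Fin r → A) (b : Fin r → B) (c : Fin r → C),
      T = ∑ i, a i ⊗ₜ[ℂ] (b i ⊗ₜ[ℂ] c i) := by
  have hadd : ∀ S T : A ⊗[ℂ] (B ⊗[ℂ] C),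
      (∃ (r : ℕ) (a : Fin r → A) (b : Fin r → B) (c : Fin r → C),
        S = ∑ i, a i ⊗ₜ[ℂ] (b i ⊗ₜ[ℂ] c i)) →
      (∃ (r : ℕ) (a : Fin r → A) (b : Fin r → B) (c : Fin r → C),
        T = ∑ i, a i ⊗ₜ[ℂ] (b i ⊗ₜ[ℂ] c i)) →
      ∃ (r : ℕ) (a : Fin r → A) (b : Fin r → B) (c : Fin r → C),
        S + T = ∑ i, a i ⊗ₜ[ℂ] (b i ⊗ₜ[ℂ] c i) := by
    rintro _ _ ⟨r, a, b, c, rfl⟩ ⟨r', a', b', c', rfl⟩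
    exact ⟨r + r', Fin.append a a', Fin.append b b', Fin.append c c', by
      simp [Fin.sum_univ_add]⟩
  induction T using TensorProduct.induction_on with
  | zero => exact ⟨0, Fin.elim0, Fin.elim0, Fin.elim0, by simp⟩
  | tmul a t =>
    induction t using TensorProduct.induction_on with
    | zero => exact ⟨0, Fin.elim0, Fin.elim0, Fin.elim0, by simp⟩
    | tmul b c => exact ⟨1, fun _ => a, fun _ => b, fun _ => c, by simp⟩
    | add s t hs ht =>
      rw [TensorProduct.tmul_add]
      exact hadd _ _ hs ht
  | add s t hs ht => exact hadd _ _ hs ht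

theorem exists_eq_sum_tensorRank (T : A ⊗[ℂ] (B ⊗[ℂ] C)) :
    ∃ (a : Fin (tensorRank T) → A) (b : Fin (tensorRank T) → B) (c : Fin (tensorRank T) → C),
      T = ∑ i, a i ⊗ₜ[ℂ] (b i ⊗ₜ[ℂ] c i) :=
  Nat.sInf_mem (exists_eq_sum_tmul T)

theorem exists_tendstoAtZero_borderRank (T : A ⊗[ℂ] (B ⊗[ℂ] C)) :
    ∃ F : ℝ → A ⊗[ℂ] (B ⊗[ℂ] C), (∀ ε : ℝ, 0 < ε → tensorRank (F ε) = borderRank T) ∧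
      TendstoAtZero F T :=
  Nat.sInf_mem (s := {r : ℕ | ∃ F : ℝ → A ⊗[ℂ] (B ⊗[ℂ] C),
    (∀ ε : ℝ, 0 < ε → tensorRank (F ε) = r) ∧ TendstoAtZero F T})
    ⟨tensorRank T, fun _ => T, fun _ _ => rfl, by
      let := moduleTopology ℂ (A ⊗[ℂ] (B ⊗[ℂ] C))
      exact tendsto_const_nhds⟩

theorem TendstoAtZero.apply {F : ℝ → A} {T : A} (h : TendstoAtZero F T) (φ : A →ₗ[ℂ] ℂ) :
    Filter.Tendsto (fun ε => φ (F ε)) (𝓝[>] (0 : ℝ)) (𝓝 (φ T)) := by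
  let := moduleTopology ℂ A
  have : IsModuleTopology ℂ A := ⟨rfl⟩
  exact ((IsModuleTopology.continuous_of_linearMap φ).tendsto T).comp h

end Tensor

/-! ### Tensors as trilinear forms, and removal of one summand on a hyperplane. -/

section Contraction

variable {U V W : Type*} [AddCommGroup U] [Module ℂ U] [AddCommGroup V] [Module ℂ V]
  [AddCommGroup W] [Module ℂ W]

/-- The value of a trilinear form on `U × V × W*`. -/
noncomputable def contraction (x : U) (y : V) (ψ : Module.Dual ℂ W) :
    Module.Dual ℂ U ⊗[ℂ] (Module.Dual ℂ V ⊗[ℂ] W) →ₗ[ℂ] ℂ :=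
  ψ ∘ₗ LinearMap.applyₗ y ∘ₗ dualTensorHom ℂ V W ∘ₗ LinearMap.applyₗ x ∘ₗ
    dualTensorHom ℂ U (Module.Dual ℂ V ⊗[ℂ] W)

theorem contraction_tmul (x : U) (y : V) (ψ : Module.Dual ℂ W) (a : Module.Dual ℂ U)
    (b : Module.Dual ℂ V) (c : W) :
    contraction x y ψ (a ⊗ₜ[ℂ] (b ⊗ₜ[ℂ] c)) = a x * b y * ψ c := by
  simp [contraction, mul_assoc]

theorem contraction_sub_smul (x w : U) (s : ℂ) (y : V) (ψ : Module.Dual ℂ W)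
    (T : Module.Dual ℂ U ⊗[ℂ] (Module.Dual ℂ V ⊗[ℂ] W)) :
    contraction (x - s • w) y ψ T = contraction x y ψ T - s * contraction w y ψ T := by
  simp [contraction]

theorem contraction_bilinearTensor [FiniteDimensional ℂ U] [FiniteDimensional ℂ V]
    (f : U →ₗ[ℂ] V →ₗ[ℂ] W) (x : U) (y : V) (ψ : Module.Dual ℂ W) :
    contraction x y ψ (bilinearTensor f) = ψ (f x y) := by
  have h1 : dualTensorHom ℂ U (Module.Dual ℂ V ⊗[ℂ] W) (bilinearTensor f) =
      (dualTensorHomEquiv ℂ V W).symm.toLinearMap ∘ₗ f :=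
    (dualTensorHomEquiv ℂ U (Module.Dual ℂ V ⊗[ℂ] W)).apply_symm_apply _
  have h2 : dualTensorHom ℂ V W ((dualTensorHomEquiv ℂ V W).symm (f x)) = f x :=
    (dualTensorHomEquiv ℂ V W).apply_symm_apply _
  simp only [contraction, LinearMap.comp_apply, h1, LinearMap.applyₗ_apply_apply,
    LinearEquiv.coe_coe, h2]

theorem contraction_structureTensor {L : Type*} [LieRing L] [LieAlgebra ℂ L]
    [FiniteDimensional ℂ L] (x y : L) (ψ : Module.Dual ℂ L) :
    contraction x y ψ (structureTensor L) = ψ ⁅x, y⁆ :=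
  contraction_bilinearTensor _ x y ψ

/-- A tensor of rank at most `m + 1` is a sum of `m` decomposable tensors on some hyperplane of the
first factor. -/
theorem exists_norm_eq_one_contraction_eq_sum {ι : Type*} [Fintype ι] [Nonempty ι]
    (e : Module.Basis ι ℂ U) {m : ℕ} (S : Module.Dual ℂ U ⊗[ℂ] (Module.Dual ℂ V ⊗[ℂ] W))
    (hS : tensorRank S ≤ m + 1) :
    ∃ z : ι → ℂ, ‖z‖ = 1 ∧ ∃ (m' : ℕ) (α : Fin m' → Module.Dual ℂ U)
      (β : Fin m' → Module.Dual ℂ V) (γ : Fin m' → W), m' ≤ m ∧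
      ∀ x, e.constr ℂ z x = 0 → ∀ y ψ,
        contraction x y ψ S = ∑ i, α i x * β i y * ψ (γ i) := by
  obtain ⟨a, b, c, h⟩ := exists_eq_sum_tensorRank S
  generalize tensorRank S = r at *
  subst h
  obtain ⟨z₁, hz₁⟩ : ∃ z : ι → ℂ, ‖z‖ = 1 := ⟨fun _ => 1, by simp⟩
  cases r with
  | zero => exact ⟨z₁, hz₁, 0, Fin.elim0, Fin.elim0, Fin.elim0, Nat.zero_le _, by simp⟩
  | succ r =>
    have hsum : ∀ x y ψ, a 0 x = 0 → contraction x y ψ (∑ i, a i ⊗ₜ[ℂ] (b i ⊗ₜ[ℂ] c i)) =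
        ∑ i : Fin r, a i.succ x * b i.succ y * ψ (c i.succ) := by
      intro x y ψ hx
      simp [map_sum, contraction_tmul, Fin.sum_univ_succ, hx]
    by_cases ha : a 0 = 0
    · exact ⟨z₁, hz₁, r, _, _, _, by omega, fun x _ y ψ => hsum x y ψ (by simp [ha])⟩
    · set z₀ : ι → ℂ := fun i => a 0 (e i)
      have hz₀ : e.constr ℂ z₀ = a 0 := e.ext fun i => e.constr_basis ℂ z₀ i
      have hne : z₀ ≠ 0 := by
        rintro h
        rw [h, map_zero] at hz₀
        exact ha hz₀.symm
      have hne' : (‖z₀‖ : ℂ)⁻¹ ≠ 0 := by simpa using hne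
      -- Scaling does not change the hyperplane `a 0 = 0`; norm one places the coefficient vectors
      -- in a compact sphere.
      refine ⟨(‖z₀‖ : ℂ)⁻¹ • z₀, ?_, r, _, _, _, by omega, fun x hx y ψ => hsum x y ψ ?_⟩
      · rw [norm_smul]
        simp [hne]
      · rw [map_smul, hz₀, LinearMap.smul_apply, smul_eq_mul] at hx
        exact (mul_eq_zero.1 hx).resolve_left hne'

end Contraction

/-! ### Border substitution. -/

/-- This continuity plays the role of semicontinuity of rank, both for the limit of tensors and for
the degeneration of hyperplanes. -/
theorem continuous_det_mul_koszulMatrix_mul {n p r : ℕ} {ι κ : Type*} [Fintype ι] [Fintype κ]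
    (L : Matrix (Fin r) ({S : Finset (Fin n) // S.card = p} × ι) ℂ)
    (N : Matrix (Finset (Fin n) × κ) (Fin r) ℂ) :
    Continuous fun t : Fin n → ι → κ → ℂ => (L * koszulMatrix p t * N).det := by
  have h : Continuous fun t : Fin n → ι → κ → ℂ => koszulMatrix p t := by
    refine continuous_matrix fun i j => ?_
    simp only [koszulMatrix, wedgeCoeff, Matrix.of_apply]
    refine continuous_finsetSum _ fun k _ => ?_
    split_ifs
    · fun_prop
    · exact continuous_const
  exact ((continuous_const.matrix_mul h).matrix_mul continuous_const).matrix_det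

theorem det_mul_koszulMatrix_mul_eq_zero {n p r m : ℕ} {ι κ : Type*} [Fintype ι] [Fintype κ]
    (α : Fin m → Fin n → ℂ) (β : Fin m → ι → ℂ) (γ : Fin m → κ → ℂ)
    (hr : m * (n - 1).choose p < r)
    (L : Matrix (Fin r) ({S : Finset (Fin n) // S.card = p} × ι) ℂ)
    (N : Matrix (Finset (Fin n) × κ) (Fin r) ℂ) :
    (L * koszulMatrix p (fun k u v => ∑ i, α i k * β i u * γ i v) * N).det = 0 := by
  by_contra h
  have h1 := Matrix.rank_of_det_ne_zero h
  rw [Fintype.card_fin] at h1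
  have h2 := (Matrix.rank_mul_le_left (L * koszulMatrix p
    (fun k u v => ∑ i, α i k * β i u * γ i v)) N).trans (Matrix.rank_mul_le_right _ _)
  have h3 := rank_koszulMatrix_sum_le (p := p) α β γ
  omega

/-- Border substitution combined with Koszul flattenings: if `T` is a limit of tensors of rank at
most `m + 1`, there is a hyperplane of the first factor on which the Koszul flattenings of `T` have
rank at most `m * (n - 1).choose p`. -/
theorem exists_hyperplane_det_eq_zero {U V W : Type*} [AddCommGroup U] [Module ℂ U]
    [FiniteDimensional ℂ U] [Nontrivial U] [AddCommGroup V] [Module ℂ V] [AddCommGroup W]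
    [Module ℂ W] {m : ℕ} {F : ℝ → Module.Dual ℂ U ⊗[ℂ] (Module.Dual ℂ V ⊗[ℂ] W)}
    {T : Module.Dual ℂ U ⊗[ℂ] (Module.Dual ℂ V ⊗[ℂ] W)}
    (hF : ∀ ε : ℝ, 0 < ε → tensorRank (F ε) ≤ m + 1) (hT : TendstoAtZero F T) :
    ∃ a : Module.Dual ℂ U, a ≠ 0 ∧ ∀ {n p r : ℕ} {ι κ : Type} [Fintype ι] [Fintype κ]
      (x : Fin n → U) (y : ι → V) (ψ : κ → Module.Dual ℂ W), (∀ k, a (x k) = 0) →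
      m * (n - 1).choose p < r →
      ∀ (L : Matrix (Fin r) ({S : Finset (Fin n) // S.card = p} × ι) ℂ)
        (N : Matrix (Finset (Fin n) × κ) (Fin r) ℂ),
        (L * koszulMatrix p (fun k u v => contraction (x k) (y u) (ψ v) T) * N).det = 0 := by
  have e := Module.finBasis ℂ U
  have : Nonempty (Fin (Module.finrank ℂ U)) := ⟨⟨0, Module.finrank_pos⟩⟩
  have hz : ∀ ε : ℝ, ∃ z : Fin (Module.finrank ℂ U) → ℂ, ‖z‖ = 1 ∧ (0 < ε →
      ∃ (m' : ℕ) (α : Fin m' → Module.Dual ℂ U)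
      (β : Fin m' → Module.Dual ℂ V) (γ : Fin m' → W), m' ≤ m ∧
      ∀ x, e.constr ℂ z x = 0 → ∀ y ψ,
        contraction x y ψ (F ε) = ∑ i, α i x * β i y * ψ (γ i)) := by
    intro ε
    by_cases hε : 0 < ε
    · obtain ⟨z, h1, h2⟩ := exists_norm_eq_one_contraction_eq_sum e (F ε) (hF ε hε)
      exact ⟨z, h1, fun _ => h2⟩
    · exact ⟨fun _ => 1, by simp, fun h => absurd h hε⟩
  choose z hz1 hz2 using hz
  -- Along an ultrafilter finer than `𝓝[>] 0` the unit functionals `z ε` converge by compactness,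
  -- without choosing a subsequence.
  set 𝒰 : Ultrafilter ℝ := Ultrafilter.of (𝓝[>] (0 : ℝ))
  have h𝒰 : (𝒰 : Filter ℝ) ≤ 𝓝[>] (0 : ℝ) := Ultrafilter.of_le _
  obtain ⟨z₀, hz₀, hlim⟩ := (isCompact_sphere (0 : Fin (Module.finrank ℂ U) → ℂ) 1).ultrafilter_le_nhds
    (𝒰.map z) (by
      rw [Filter.le_principal_iff]
      exact Filter.mem_map.2 (Filter.univ_mem' fun ε => by simp [hz1 ε]))
  have hlim' : Filter.Tendsto z 𝒰 (𝓝 z₀) := hlim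
  have hz₀ne : z₀ ≠ 0 := by
    rintro rfl
    simp at hz₀
  have hconstr : ∀ x, Filter.Tendsto (fun ε => e.constr ℂ (z ε) x) 𝒰 (𝓝 (e.constr ℂ z₀ x)) := by
    intro x
    have hc : Continuous fun z : Fin (Module.finrank ℂ U) → ℂ => e.constr ℂ z x := by
      simp only [Module.Basis.constr_apply_fintype]
      fun_prop
    exact (hc.tendsto z₀).comp hlim'
  obtain ⟨i, hi⟩ : ∃ i, z₀ i ≠ 0 := by
    by_contra! h
    exact hz₀ne (funext h)
  have hw : e.constr ℂ z₀ (e i) ≠ 0 := by simpa using hi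
  refine ⟨e.constr ℂ z₀, fun h => hw (by simp [h]), ?_⟩
  intro n p r ι κ _ _ x y ψ hx hr L N
  -- Moving `x k` along `e i`, where the limit functional is nonzero, puts it in the hyperplane of
  -- `z ε`. The correction `s ε k` tends to 0 because `x k` lies in the limit hyperplane.
  set s : ℝ → Fin n → ℂ := fun ε k => e.constr ℂ (z ε) (x k) / e.constr ℂ (z ε) (e i)
  have hs : ∀ k, Filter.Tendsto (fun ε => s ε k) 𝒰 (𝓝 0) := by
    intro k
    have := (hconstr (x k)).div (hconstr (e i)) hw
    rwa [hx k, zero_div] at this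
  set t : ℝ → Fin n → ι → κ → ℂ := fun ε k u v =>
    contraction (x k - s ε k • e i) (y u) (ψ v) (F ε)
  have ht : Filter.Tendsto t 𝒰 (𝓝 fun k u v => contraction (x k) (y u) (ψ v) T) := by
    refine tendsto_pi_nhds.2 fun k => tendsto_pi_nhds.2 fun u => tendsto_pi_nhds.2 fun v => ?_
    simp only [t, contraction_sub_smul]
    have h1 := (hT.apply (contraction (x k) (y u) (ψ v))).mono_left h𝒰
    have h2 := (hT.apply (contraction (e i) (y u) (ψ v))).mono_left h𝒰
    simpa using h1.sub ((hs k).mul h2)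
  have hdet := ((continuous_det_mul_koszulMatrix_mul L N).tendsto _).comp ht
  refine tendsto_nhds_unique hdet (tendsto_const_nhds.congr' ?_)
  have hpos : ∀ᶠ ε in (𝒰 : Filter ℝ), 0 < ε := h𝒰 self_mem_nhdsWithin
  filter_upwards [hpos, (hconstr (e i)).eventually_ne hw] with ε hε hne
  obtain ⟨m', α, β, γ, hm', hsum⟩ := hz2 ε hε
  have hker : ∀ k, e.constr ℂ (z ε) (x k - s ε k • e i) = 0 := by
    intro k
    rw [map_sub, map_smul, smul_eq_mul, div_mul_cancel₀ _ hne, sub_self]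
  have ht' : t ε = fun k u v => ∑ j, α j (x k - s ε k • e i) * β j (y u) * ψ v (γ j) :=
    funext fun k => funext fun u => funext fun v => hsum _ (hker k) _ _
  simp only [Function.comp_apply, ht']
  exact (det_mul_koszulMatrix_mul_eq_zero (fun j k => α j (x k - s ε k • e i))
    (fun j u => β j (y u)) (fun j v => ψ v (γ j))
    ((Nat.mul_le_mul_right _ hm').trans_lt hr) L N).symm

/-! ### Conjugation and torus degeneration of hyperplanes in `sl₄`. -/

section

attribute [local instance] LieRing.ofAssociativeRing

/-- The projection onto the traceless matrices along the scalar matrices. -/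
noncomputable def toTraceless :
    Matrix (Fin 4) (Fin 4) ℂ →ₗ[ℂ] LieAlgebra.SpecialLinear.sl (Fin 4) ℂ where
  toFun M := ⟨M - ((4 : ℂ)⁻¹ * M.trace) • 1, by
    change Matrix.trace (M - ((4 : ℂ)⁻¹ * M.trace) • 1) = 0
    simp [Matrix.trace_sub, Matrix.trace_smul, mul_comm]⟩
  map_add' M N := Subtype.ext <| by
    change M + N - _ = M - _ + (N - _)
    rw [Matrix.trace_add]
    module
  map_smul' c M := Subtype.ext <| by
    change c • M - _ = c • (M - _)
    rw [Matrix.trace_smul, smul_eq_mul]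
    module

theorem coe_toTraceless (M : Matrix (Fin 4) (Fin 4) ℂ) :
    (toTraceless M : Matrix (Fin 4) (Fin 4) ℂ) = M - ((4 : ℂ)⁻¹ * M.trace) • 1 := rfl

theorem coe_lie_toTraceless (M N : Matrix (Fin 4) (Fin 4) ℂ) :
    ((⁅toTraceless M, toTraceless N⁆ : LieAlgebra.SpecialLinear.sl (Fin 4) ℂ) :
      Matrix (Fin 4) (Fin 4) ℂ) = M * N - N * M := by
  rw [LieAlgebra.SpecialLinear.sl_bracket]
  simp only [coe_toTraceless, sub_mul, mul_sub, smul_mul_assoc, mul_smul_comm, one_mul, mul_one]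
  module

theorem toTraceless_one : toTraceless 1 = 0 := by
  ext i j
  simp [coe_toTraceless]

theorem toTraceless_surjective : Function.Surjective toTraceless := by
  intro x
  refine ⟨x, Subtype.ext ?_⟩
  have h : (x : Matrix (Fin 4) (Fin 4) ℂ).trace = 0 := x.2
  rw [coe_toTraceless, h]
  simp

/-- A linear functional on matrices that is not constant on diagonal matrix units, or does not
vanish on all other matrix units, is nonzero on a conjugate of the lower left matrix unit. -/
theorem exists_apply_mul_single_mul_ne_zero (b : Module.Dual ℂ (Matrix (Fin 4) (Fin 4) ℂ))
    (hb1 : b 1 = 0) (hb : b ≠ 0) :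
    ∃ P Q : Matrix (Fin 4) (Fin 4) ℂ, P * Q = 1 ∧ b (P * Matrix.single 3 0 1 * Q) ≠ 0 := by
  have hperm : ∀ i j : Fin 4, i ≠ j → ∃ σ : Equiv.Perm (Fin 4), σ 3 = i ∧ σ 0 = j := by decide
  have key : ∀ (b : Module.Dual ℂ (Matrix (Fin 4) (Fin 4) ℂ)) (i j : Fin 4), i ≠ j →
      b (Matrix.single i j 1) ≠ 0 →
      ∃ P Q : Matrix (Fin 4) (Fin 4) ℂ, P * Q = 1 ∧ b (P * Matrix.single 3 0 1 * Q) ≠ 0 := by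
    intro b i j hij hbij
    obtain ⟨σ, h3, h0⟩ := hperm i j hij
    refine ⟨(σ.symm.toPEquiv.toMatrix : Matrix (Fin 4) (Fin 4) ℂ), σ.toPEquiv.toMatrix, ?_, ?_⟩
    · rw [← PEquiv.toMatrix_trans, ← Equiv.toPEquiv_trans]
      simp
    · have : (σ.symm.toPEquiv.toMatrix : Matrix (Fin 4) (Fin 4) ℂ) * Matrix.single 3 0 1 *
          σ.toPEquiv.toMatrix = Matrix.single i j 1 := by
        rw [PEquiv.toMatrix_toPEquiv_mul, PEquiv.mul_toMatrix_toPEquiv]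
        ext a c
        simp only [Matrix.submatrix_apply, Matrix.single_apply, id, ← h3, ← h0,
          Equiv.eq_symm_apply]
      rwa [this]
  by_cases h : ∃ i j : Fin 4, i ≠ j ∧ b (Matrix.single i j 1) ≠ 0
  · obtain ⟨i, j, hij, h⟩ := h
    exact key b i j hij h
  push Not at h
  by_cases h' : ∃ i j : Fin 4, i ≠ j ∧ b (Matrix.single i i 1) ≠ b (Matrix.single j j 1)
  · obtain ⟨i, j, hij, h'⟩ := h'
    -- Conjugating `E_ij` by `1 + E_ji` produces the diagonal part `E_jj - E_ii`, on which `b` is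
    -- nonzero.
    set u : Matrix (Fin 4) (Fin 4) ℂ := 1 + Matrix.single j i 1
    set u' : Matrix (Fin 4) (Fin 4) ℂ := 1 - Matrix.single j i 1
    have hsq : (Matrix.single j i 1 : Matrix (Fin 4) (Fin 4) ℂ) * Matrix.single j i 1 = 0 :=
      Matrix.single_mul_single_of_ne _ _ _ _ hij _
    have huu : u * u' = 1 := by
      simp [u, u', add_mul, mul_sub, hsq]
    set b' : Module.Dual ℂ (Matrix (Fin 4) (Fin 4) ℂ) :=
      b ∘ₗ LinearMap.mulLeft ℂ u ∘ₗ LinearMap.mulRight ℂ u'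
    have hb' : ∀ M, b' M = b (u * (M * u')) := fun M => rfl
    obtain ⟨P, Q, hPQ, hne⟩ := key b' i j hij (by
      rw [hb']
      have : u * (Matrix.single i j 1 * u') = Matrix.single i j 1 + Matrix.single j j 1 -
          Matrix.single i i 1 - Matrix.single j i 1 := by
        simp only [u, u', mul_sub, mul_one, add_mul, one_mul, Matrix.single_mul_single_same]
        abel
      rw [this, map_sub, map_sub, map_add, h i j hij, h j i hij.symm, zero_add, sub_zero]
      exact sub_ne_zero.2 h'.symm)
    refine ⟨u * P, Q * u', ?_, ?_⟩
    · rw [mul_assoc, ← mul_assoc P, hPQ, one_mul, huu]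
    · rw [hb'] at hne
      simpa only [mul_assoc] using hne
  · push Not at h'
    refine absurd (LinearMap.ext fun M => ?_) hb
    have hii : ∀ i, b (Matrix.single i i 1) = b (Matrix.single 0 0 1) := by
      intro i
      by_cases hi : i = 0
      · rw [hi]
      · exact h' i 0 hi
    have hdiag : ∀ i, b (Matrix.single i i 1) = 0 := by
      have h1 : (1 : Matrix (Fin 4) (Fin 4) ℂ) = ∑ i, Matrix.single i i 1 := by
        rw [Matrix.sum_single_eq_diagonal]
        simp
      rw [h1, map_sum, Finset.sum_congr rfl fun i _ => hii i] at hb1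
      intro i
      rw [hii i]
      simpa using hb1
    rw [Matrix.matrix_eq_sum_single M, map_sum]
    refine Finset.sum_eq_zero fun i _ => ?_
    rw [map_sum]
    refine Finset.sum_eq_zero fun j _ => ?_
    have : Matrix.single i j (M i j) = M i j • Matrix.single i j (1 : ℂ) := by simp
    rw [this, map_smul]
    by_cases hij : i = j
    · rw [hij, hdiag j, smul_zero]
    · rw [h i j hij, smul_zero]

theorem unitCommutator_eq (X : Matrix (Fin 4) (Fin 4) ℂ) (u v : Fin 4 × Fin 4) :
    unitCommutator X u v =
      (X * Matrix.single u.1 u.2 1 - Matrix.single u.1 u.2 1 * X :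
        Matrix (Fin 4) (Fin 4) ℂ) v.1 v.2 := by
  simp [unitCommutator, Matrix.mul_apply, Matrix.single_apply, ite_and]

theorem generator_three_zero (k : Fin 9) : generator k 3 0 = 0 := by
  revert k
  decide

theorem map_koszulMatrix {n p : ℕ} {ι κ R S : Type*} [CommRing R] [CommRing S] (f : R →+* S)
    (t : Fin n → ι → κ → R) :
    (koszulMatrix p t).map f = koszulMatrix p (fun k u v => f (t k u v)) := by
  ext r s
  simp only [koszulMatrix, wedgeCoeff, Matrix.map_apply, Matrix.of_apply, map_sum]
  refine Finset.sum_congr rfl fun k _ => ?_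
  split_ifs <;> simp

/-- The diagonal exponents of a one-parameter group that contracts everything towards the lower left
matrix unit. -/
def torusWeight : Fin 4 → ℕ := ![2, 1, 1, 0]

theorem torusWeight_le (j : Fin 4) : torusWeight j ≤ 2 := by
  revert j
  decide

/-- After multiplication by `s ^ 2`, every matrix unit except the lower left one has a positive
power of `s`. The subtraction never truncates, by `torusWeight_le`. -/
theorem torusWeight_pos_of_ne (i j : Fin 4) (h : ¬(i = 3 ∧ j = 0)) :
    torusWeight i + 2 - torusWeight j ≠ 0 := by
  revert i j
  decide

/-- On every hyperplane of `sl₄` some Koszul flattening of the bracket has rank at least `1821`. -/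
theorem exists_det_koszulMatrix_lie_ne_zero
    (a : Module.Dual ℂ (LieAlgebra.SpecialLinear.sl (Fin 4) ℂ)) (ha : a ≠ 0) :
    ∃ (x : Fin 9 → LieAlgebra.SpecialLinear.sl (Fin 4) ℂ)
      (y : Fin 4 × Fin 4 → LieAlgebra.SpecialLinear.sl (Fin 4) ℂ)
      (ψ : Fin 4 × Fin 4 → Module.Dual ℂ (LieAlgebra.SpecialLinear.sl (Fin 4) ℂ)),
      (∀ k, a (x k) = 0) ∧ ∃ r, 1821 ≤ r ∧
        ∃ (L : Matrix (Fin r) ({S : Finset (Fin 9) // S.card = 4} × (Fin 4 × Fin 4)) ℂ)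
          (N : Matrix (Finset (Fin 9) × (Fin 4 × Fin 4)) (Fin r) ℂ),
          (L * koszulMatrix 4 (fun k u v => ψ v ⁅x k, y u⁆) * N).det ≠ 0 := by
  obtain ⟨r, hr, L₀, N₀, hdet₀⟩ := exists_det_koszulMatrix_generator_ne_zero
  set b : Module.Dual ℂ (Matrix (Fin 4) (Fin 4) ℂ) := a ∘ₗ toTraceless
  have hb : b ≠ 0 := by
    intro h
    refine ha (LinearMap.ext fun x => ?_)
    obtain ⟨M, rfl⟩ := toTraceless_surjective x
    exact LinearMap.congr_fun h M
  obtain ⟨P, Q, hPQ, hne⟩ := exists_apply_mul_single_mul_ne_zero b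
    (by simp [b, toTraceless_one]) hb
  set l : Fin 4 → Fin 4 → ℂ := fun i j => b (P * Matrix.single i j 1 * Q)
  set X : Fin 9 → Matrix (Fin 4) (Fin 4) ℂ := fun k => (generator k).map (Int.castRingHom ℂ)
  have hX : ∀ k, X k 3 0 = 0 := fun k => by simp [X, generator_three_zero]
  -- The multiple of the lower left unit that must be added to `X k` so that its conjugate by `P *
  -- D` lies in the kernel of `b`. It is polynomial in `s` and vanishes at `s = 0`.
  set c : ℂ → Fin 9 → ℂ := fun s k => -(l 3 0)⁻¹ *
    ∑ i, ∑ j, X k i j * s ^ (torusWeight i + 2 - torusWeight j) * l i j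
  have hc0 : ∀ k, c 0 k = 0 := by
    intro k
    refine mul_eq_zero_of_right _ (Finset.sum_eq_zero fun i _ => Finset.sum_eq_zero fun j _ => ?_)
    by_cases hij : i = 3 ∧ j = 0
    · rw [hij.1, hij.2, hX, zero_mul, zero_mul]
    · rw [zero_pow (torusWeight_pos_of_ne i j hij), mul_zero, zero_mul]
  set Y : ℂ → Fin 9 → Matrix (Fin 4) (Fin 4) ℂ := fun s k => X k + c s k • Matrix.single 3 0 1
  set L := L₀.map (Int.castRingHom ℂ)
  set N := N₀.map (Int.castRingHom ℂ)
  set f : ℂ → ℂ := fun s => (L * koszulMatrix 4 (fun k u v => unitCommutator (Y s k) u v) * N).det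
  have hf0 : f 0 ≠ 0 := by
    have h : koszulMatrix 4 (fun k u v => unitCommutator (Y 0 k) u v) =
        (koszulMatrix 4 fun k u v => unitCommutator (generator k) u v).map
          (Int.castRingHom ℂ) := by
      rw [map_koszulMatrix]
      congr 1
      funext k u v
      simp only [Y, hc0, zero_smul, add_zero, X, unitCommutator, Matrix.map_apply, map_sub]
      split_ifs <;> simp
    simp only [f, h, L, N]
    rw [← Matrix.map_mul, ← Matrix.map_mul, ← RingHom.mapMatrix_apply, ← RingHom.map_det]
    simpa using hdet₀
  have hfc : Continuous f := by
    refine (continuous_det_mul_koszulMatrix_mul L N).comp ?_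
    refine continuous_pi fun k => continuous_pi fun u => continuous_pi fun v => ?_
    have hY : ∀ i j, Continuous fun s => Y s k i j := by
      intro i j
      simp only [Y, c, Matrix.add_apply, Matrix.smul_apply]
      fun_prop
    simp only [unitCommutator]
    refine Continuous.sub ?_ ?_ <;> split_ifs
    all_goals first | exact hY _ _ | exact continuous_const
  -- At `s = 0` the torus element is not invertible, so a nearby nonzero `s` is taken, where the
  -- determinant is still nonzero.
  obtain ⟨s, hfs, hs⟩ : ∃ s, f s ≠ 0 ∧ s ≠ 0 := by
    have h1 : ∀ᶠ s in 𝓝[≠] (0 : ℂ), f s ≠ 0 :=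
      ((hfc.tendsto 0).eventually_ne hf0).filter_mono nhdsWithin_le_nhds
    exact (h1.and self_mem_nhdsWithin).exists
  set D : Matrix (Fin 4) (Fin 4) ℂ := Matrix.diagonal fun i => s ^ torusWeight i
  set D' : Matrix (Fin 4) (Fin 4) ℂ := Matrix.diagonal fun i => (s ^ torusWeight i)⁻¹
  have hDD : D' * D = 1 := by
    simp [D, D', Matrix.diagonal_mul_diagonal, hs]
  have hHG : (D' * Q) * (P * D) = 1 := by
    rw [mul_assoc, ← mul_assoc Q, mul_eq_one_comm.1 hPQ, one_mul, hDD]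
  have hunit : ∀ i j, b (P * D * Matrix.single i j 1 * (D' * Q)) =
      s ^ torusWeight i * (s ^ torusWeight j)⁻¹ * l i j := by
    intro i j
    have h : D * Matrix.single i j 1 * D' =
        (s ^ torusWeight i * (s ^ torusWeight j)⁻¹) • Matrix.single i j 1 := by
      ext p q
      simp only [D, D', Matrix.mul_diagonal, Matrix.diagonal_mul, Matrix.smul_apply,
        Matrix.single_apply]
      split_ifs with hpq
      · rw [hpq.1, hpq.2]
        simp
      · simp
    have h' : P * D * Matrix.single i j 1 * (D' * Q) =
        (s ^ torusWeight i * (s ^ torusWeight j)⁻¹) • (P * Matrix.single i j 1 * Q) := by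
      rw [show P * D * Matrix.single i j 1 * (D' * Q) = P * (D * Matrix.single i j 1 * D') * Q by
        simp only [mul_assoc], h, mul_smul_comm, smul_mul_assoc]
    rw [h', map_smul, smul_eq_mul]
  have hexp : ∀ M : Matrix (Fin 4) (Fin 4) ℂ, b (P * D * M * (D' * Q)) =
      ∑ i, ∑ j, M i j * (s ^ torusWeight i * (s ^ torusWeight j)⁻¹ * l i j) := by
    intro M
    conv_lhs => rw [Matrix.matrix_eq_sum_single M]
    simp only [Finset.mul_sum, Finset.sum_mul, map_sum]
    refine Finset.sum_congr rfl fun i _ => Finset.sum_congr rfl fun j _ => ?_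
    have : Matrix.single i j (M i j) = M i j • Matrix.single i j (1 : ℂ) := by simp
    rw [this, mul_smul_comm, smul_mul_assoc, map_smul, hunit, smul_eq_mul]
  -- Both arguments are conjugated by `P * D` and the functionals conjugate back before reading an
  -- entry. Scalar parts removed by `toTraceless` do not affect commutators, so the array is exactly
  -- `unitCommutator (Y s k)`.
  refine ⟨fun k => toTraceless (P * D * Y s k * (D' * Q)),
    fun u => toTraceless (P * D * Matrix.single u.1 u.2 1 * (D' * Q)),
    fun v => Matrix.entryLinearMap ℂ ℂ v.1 v.2 ∘ₗ LinearMap.mulLeft ℂ (D' * Q) ∘ₗ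
      LinearMap.mulRight ℂ (P * D) ∘ₗ
        (LieAlgebra.SpecialLinear.sl (Fin 4) ℂ).toSubmodule.subtype, ?_, r, hr, L, N, ?_⟩
  · intro k
    change b (P * D * (X k + c s k • Matrix.single 3 0 1) * (D' * Q)) = 0
    rw [mul_add, add_mul, map_add, mul_smul_comm, smul_mul_assoc, map_smul, hunit, hexp]
    simp only [c, smul_eq_mul]
    have h3 : s ^ torusWeight 3 * (s ^ torusWeight 0)⁻¹ * l 3 0 = (s ^ 2)⁻¹ * l 3 0 := by
      simp [torusWeight]
    have hl : l 3 0 ≠ 0 := hne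
    have hsum : ∑ i, ∑ j, X k i j * s ^ (torusWeight i + 2 - torusWeight j) * l i j =
        s ^ 2 * ∑ i, ∑ j, X k i j * (s ^ torusWeight i * (s ^ torusWeight j)⁻¹ * l i j) := by
      simp only [Finset.mul_sum]
      refine Finset.sum_congr rfl fun i _ => Finset.sum_congr rfl fun j _ => ?_
      rw [pow_sub₀ s hs ((torusWeight_le j).trans (Nat.le_add_left _ _)), pow_add]
      ring
    rw [h3, hsum]
    field_simp
    ring
  · convert hfs using 5
    funext k u v
    change ((D' * Q) * (((⁅toTraceless _, toTraceless _⁆ :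
      LieAlgebra.SpecialLinear.sl (Fin 4) ℂ) : Matrix (Fin 4) (Fin 4) ℂ) * (P * D))) v.1 v.2 = _
    rw [coe_lie_toTraceless, unitCommutator_eq]
    generalize P * D = G at *
    generalize D' * Q = H at *
    have h1 : ∀ A B : Matrix (Fin 4) (Fin 4) ℂ, H * (G * A * H * (G * B * H) * G) = A * B := by
      intro A B
      calc H * (G * A * H * (G * B * H) * G) = (H * G) * A * (H * G) * B * (H * G) := by
            simp only [mul_assoc]
        _ = A * B := by simp [hHG]
    rw [sub_mul, mul_sub, h1, h1]

end

/-! ### The contradiction between 1820 and 1821. -/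

theorem theorem3 :
    28 ≤ borderRank (structureTensor (LieAlgebra.SpecialLinear.sl (Fin 4) ℂ)) := by
  by_contra hlt
  obtain ⟨F, hF, hT⟩ := exists_tendstoAtZero_borderRank
    (structureTensor (LieAlgebra.SpecialLinear.sl (Fin 4) ℂ))
  have : Nontrivial (LieAlgebra.SpecialLinear.sl (Fin 4) ℂ) :=
    ⟨LieAlgebra.SpecialLinear.single 0 1 (by decide) 1, 0, fun h => by
      simpa using congrFun (congrFun (congrArg Subtype.val h) 0) 1⟩
  -- Border rank at most 27 leaves 26 summands on the hyperplane.
  obtain ⟨a, ha, h⟩ := exists_hyperplane_det_eq_zero (m := 26)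
    (fun ε hε => by rw [hF ε hε]; omega) hT
  obtain ⟨x, y, ψ, hx, r, hr, L, N, hdet⟩ := exists_det_koszulMatrix_lie_ne_zero a ha
  refine hdet ?_
  have h' := h x y ψ hx (r := r) (p := 4) (lt_of_lt_of_le (by decide) hr) L N
  simpa only [contraction_structureTensor] using h'
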